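/- All graphs are finite and simple. An Ore-composition of graphs $G_1$ and $G_2$ is a graph obtained by deleting an edge $xy$ of $G_1$, splitting a vertex $z$ of $G_2$ into two vertices $z_1,z_2$ of positive degree (each edge at $z$ becomes an edge at exactly one of $z_1,z_2$), and identifying $x$ with $z_1$ and $y$ with $z_2$. A $4$-Ore graph is a graph obtained from copies of $K_4$ by repeated Ore-compositions. The Ore-degree of a graph $G$ is the maximum of $d(u)+d(v)$ over all edges $uv\in E(G)$. A diamond of $G$ is a (not necessarily induced) subgraph isomorphic to $K_4-e$ whose two vertices of degree three in the subgraph also have degree three in $G$; its ends are its two other vertices, those of degree two in the subgraph. Let $H_7$ denote the unique (up to isomorphism) Ore-composition of two copies of $K_4$. If $G$ is a $4$-Ore graph of Ore-degree at most $7$, then at least one of the following holds: (1) $G$ is isomorphic to $K_4$ or to $H_7$; (2) $G$ has a diamond both of whose ends have degree $4$ in $G$; (3) $G$ has a diamond such that one of its ends has degree $4$ in $G$ and the other end has degree $3$ in $G$ and has a neighbor of degree $4$ in $G$. -/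

import Mathlib

universe u

/-- The Ore-composition of `G₁` and `G₂`: delete the edge `xy` of `G₁`, split the vertex `z` of `G₂`
into `z₁`, which keeps the neighbours of `z` lying in `A`, and `z₂`, which keeps the remaining
neighbours of `z`, then identify `x` with `z₁` and `y` with `z₂`.  The requirements that `xy` is an
edge and that `z₁`, `z₂` have positive degree are imposed in `IsOreComposition`. -/
def oreComposition {V₁ V₂ : Type u} (G₁ : SimpleGraph V₁) (G₂ : SimpleGraph V₂)
    (x y : V₁) (z : V₂) (A : Set V₂) : SimpleGraph (V₁ ⊕ {v : V₂ // v ≠ z}) where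
  Adj
    | .inl a, .inl b => G₁.Adj a b ∧ s(a, b) ≠ s(x, y)
    | .inr u, .inr v => G₂.Adj u v
    | .inl a, .inr v => G₂.Adj z v ∧ ((a = x ∧ (v : V₂) ∈ A) ∨ (a = y ∧ (v : V₂) ∉ A))
    | .inr v, .inl a => G₂.Adj z v ∧ ((a = x ∧ (v : V₂) ∈ A) ∨ (a = y ∧ (v : V₂) ∉ A))
  symm := ⟨by
    rintro (a | u) (b | v) h
    · exact ⟨h.1.symm, by rw [Sym2.eq_swap]; exact h.2⟩
    · exact h
    · exact h
    · exact G₂.adj_symm h⟩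
  loopless := ⟨by
    rintro (a | u) h
    · exact G₁.irrefl h.1
    · exact G₂.irrefl h⟩

/-- `G` is (isomorphic to) an Ore-composition with edge-side `G₁` and split-side `G₂`. -/
def IsOreComposition {V₁ V₂ V : Type u} (G₁ : SimpleGraph V₁) (G₂ : SimpleGraph V₂)
    (G : SimpleGraph V) : Prop :=
  ∃ (x y : V₁) (z : V₂) (A : Set V₂), G₁.Adj x y ∧
    (∃ v, G₂.Adj z v ∧ v ∈ A) ∧ (∃ v, G₂.Adj z v ∧ v ∉ A) ∧
    Nonempty (G ≃g oreComposition G₁ G₂ x y z A)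

/-- `k`-Ore graphs: the graphs obtained from copies of `K_k` by repeated Ore-compositions. -/
inductive IsOreGraph (k : ℕ) : {V : Type u} → SimpleGraph V → Prop
  | complete {V : Type u} (G : SimpleGraph V)
      (h : Nonempty (G ≃g (⊤ : SimpleGraph (Fin k)))) : IsOreGraph k G
  | comp {V₁ V₂ V : Type u} (G₁ : SimpleGraph V₁) (G₂ : SimpleGraph V₂) (G : SimpleGraph V)
      (h₁ : IsOreGraph k G₁) (h₂ : IsOreGraph k G₂) (h : IsOreComposition G₁ G₂ G) :
      IsOreGraph k G

/-- The Ore-degree of a finite graph: the maximum of `d(u) + d(v)` over all edges `uv`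
(and `0` if there is no edge). -/
def oreDegree {V : Type u} [Fintype V] (G : SimpleGraph V) [DecidableRel G.Adj] : ℕ :=
  (Finset.univ.filter fun p : V × V => G.Adj p.1 p.2).sup fun p => G.degree p.1 + G.degree p.2

/-- The graph `H₇`, the Ore-composition of two copies of `K₄`.  All choices of the replaced edge,
of the split vertex and of the split (one neighbour on one side, two on the other) give isomorphic
graphs; here is one of them. -/
def H7 : SimpleGraph (Fin 4 ⊕ {v : Fin 4 // v ≠ 0}) :=
  oreComposition (⊤ : SimpleGraph (Fin 4)) (⊤ : SimpleGraph (Fin 4)) 0 1 0 {1}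

/-- `a, b, c, d` span a diamond of `G` with ends `a, b` and internal vertices `c, d`: they are the
vertices of a subgraph `K₄ - ab` (not necessarily induced) whose vertices `c, d` of degree three
in that subgraph also have degree three in `G`. -/
structure IsDiamond {V : Type u} [Fintype V] (G : SimpleGraph V) [DecidableRel G.Adj]
    (a b c d : V) : Prop where
  ends_ne : a ≠ b
  adj_ac : G.Adj a c
  adj_ad : G.Adj a d
  adj_bc : G.Adj b c
  adj_bd : G.Adj b d
  adj_cd : G.Adj c d
  degree_c : G.degree c = 3
  degree_d : G.degree d = 3

-- Induct on the Ore-composition, with conclusion `K₄`, `H₇` or a good diamond. Composition does not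
-- lower degrees, so every degree is at least 3. Ore-degree at most 7 then bounds all degrees by 4
-- and makes the vertices of degree 4 independent.
--
-- In a composition, name the ends of the deleted edge so that `x` receives at least two neighbours
-- of `z`. Its new degree is at least 3 - 1 + 2 = 4, so equality holds throughout (`deg_x`): `x` has
-- degree 3 in `G₁`, degree 4 in the composition, and only neighbours of degree 3 there. Both
-- factors inherit the Ore-degree bound, so induction applies to them.
--
-- If `G₁` is `K₄`, the two vertices off the deleted edge span a diamond with ends `x`, `y`. Unless
-- it is good, `z` and its neighbours have degree 3 in `G₂`; then `G₂ = K₄` gives `H₇`, and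
-- otherwise a good diamond survives or arises at the split. If `G₁` is `H₇` or has a good diamond,
-- a good diamond survives on the left unless `y` has degree 4 in `G₁`; in that case one comes from
-- `G₂` (`good_of_deg_y_eq_four`). Of `H₇` only the two diamonds sharing an end of degree 4 are
-- used.

universe v

/-! ### Degrees, diamonds and invariance under isomorphism -/

namespace SimpleGraph

/-- The degree of a vertex, as the cardinality of its neighbour set, without decidability data. -/
noncomputable def deg {V : Type*} (G : SimpleGraph V) (v : V) : ℕ := (G.neighborSet v).ncard

/-- The endpoints of every edge have degrees summing up to at most seven. -/
def EdgeDegLESeven {V : Type*} (G : SimpleGraph V) : Prop :=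
  ∀ u v, G.Adj u v → G.deg u + G.deg v ≤ 7

/-- A diamond with ends `a, b` and internal vertices `c, d`. -/
structure Diamond {V : Type*} (G : SimpleGraph V) (a b c d : V) : Prop where
  ends_ne : a ≠ b
  adj_ac : G.Adj a c
  adj_ad : G.Adj a d
  adj_bc : G.Adj b c
  adj_bd : G.Adj b d
  adj_cd : G.Adj c d
  deg_c : G.deg c = 3
  deg_d : G.deg d = 3

/-- Some diamond has an end of degree four, while the other end has degree four or a neighbour of
degree four. -/
def HasGoodDiamond {V : Type*} (G : SimpleGraph V) : Prop :=
  ∃ a b c d, G.Diamond a b c d ∧ G.deg a = 4 ∧ (G.deg b = 4 ∨ ∃ w, G.Adj b w ∧ G.deg w = 4)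

/-- The vertices are `s, t, m, p, q, v, w`, the middle vertex `m` has degree four and is an end of
the diamonds on `s, m, p, q` and `t, m, v, w`, and `s, t` are adjacent vertices of degree three. -/
structure DoubleDiamond {V : Type*} (G : SimpleGraph V) (s t m p q v w : V) : Prop where
  cover : ∀ a, a = s ∨ a = t ∨ a = m ∨ a = p ∨ a = q ∨ a = v ∨ a = w
  nodup : [s, t, m, p, q, v, w].Nodup
  diamond_s : G.Diamond m s p q
  diamond_t : G.Diamond m t v w
  adj_st : G.Adj s t
  deg_m : G.deg m = 4
  deg_s : G.deg s = 3
  deg_t : G.deg t = 3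

/-- The graph is `K₄`, has the structure of `H₇`, or has a good diamond. -/
def Trichotomy {V : Type*} (G : SimpleGraph V) : Prop :=
  Nonempty (G ≃g (⊤ : SimpleGraph (Fin 4))) ∨ (∃ s t m p q v w, G.DoubleDiamond s t m p q v w) ∨
    G.HasGoodDiamond

variable {V W : Type*} {G : SimpleGraph V} {H : SimpleGraph W}

theorem deg_iso (e : G ≃g H) (v : V) : H.deg (e v) = G.deg v := by
  unfold deg
  rw [← Set.ncard_image_of_injective _ e.injective]
  congr 1
  ext w
  simp only [mem_neighborSet, Set.mem_image]
  constructor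
  · intro h
    exact ⟨e.symm w, by rw [← e.map_adj_iff]; simpa using h, by simp⟩
  · rintro ⟨u, hu, rfl⟩
    exact e.map_adj_iff.2 hu

theorem deg_eq_degree [Fintype V] [DecidableRel G.Adj] (v : V) : G.deg v = G.degree v := by
  unfold deg
  rw [Set.ncard_eq_toFinset_card', ← card_neighborSet_eq_degree, Set.toFinset_card]

theorem Diamond.symm_internal {a b c d : V} (h : G.Diamond a b c d) : G.Diamond a b d c :=
  ⟨h.ends_ne, h.adj_ad, h.adj_ac, h.adj_bd, h.adj_bc, h.adj_cd.symm, h.deg_d, h.deg_c⟩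

theorem Diamond.map_iso (e : G ≃g H) {a b c d : V} (h : G.Diamond a b c d) :
    H.Diamond (e a) (e b) (e c) (e d) :=
  ⟨e.injective.ne h.ends_ne, e.map_adj_iff.2 h.adj_ac, e.map_adj_iff.2 h.adj_ad,
    e.map_adj_iff.2 h.adj_bc, e.map_adj_iff.2 h.adj_bd, e.map_adj_iff.2 h.adj_cd,
    (deg_iso e c).trans h.deg_c, (deg_iso e d).trans h.deg_d⟩

theorem HasGoodDiamond.of_iso (e : G ≃g H) (h : G.HasGoodDiamond) : H.HasGoodDiamond := by
  obtain ⟨a, b, c, d, hD, ha, hb⟩ := h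
  refine ⟨e a, e b, e c, e d, hD.map_iso e, (deg_iso e a).trans ha, ?_⟩
  rcases hb with hb | ⟨w, hw, hw4⟩
  · exact Or.inl ((deg_iso e b).trans hb)
  · exact Or.inr ⟨e w, e.map_adj_iff.2 hw, (deg_iso e w).trans hw4⟩

theorem EdgeDegLESeven.of_iso (e : G ≃g H) (h : G.EdgeDegLESeven) : H.EdgeDegLESeven := by
  intro u v huv
  have := h (e.symm u) (e.symm v) (e.symm.map_adj_iff.2 huv)
  rwa [deg_iso e.symm, deg_iso e.symm] at this

theorem DoubleDiamond.symm {s t m p q v w : V} (h : G.DoubleDiamond s t m p q v w) :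
    G.DoubleDiamond t s m v w p q where
  cover a := by have := h.cover a; tauto
  nodup := by
    have := h.nodup
    simp only [List.nodup_cons, List.mem_cons, List.not_mem_nil, or_false, not_or,
      List.nodup_nil, and_true, not_false_eq_true] at this ⊢
    grind
  diamond_s := h.diamond_t
  diamond_t := h.diamond_s
  adj_st := h.adj_st.symm
  deg_m := h.deg_m
  deg_s := h.deg_t
  deg_t := h.deg_s

theorem DoubleDiamond.map_iso (e : G ≃g H) {s t m p q v w : V}
    (h : G.DoubleDiamond s t m p q v w) :
    H.DoubleDiamond (e s) (e t) (e m) (e p) (e q) (e v) (e w) where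
  cover a := by
    have := h.cover (e.symm a)
    simpa only [RelIso.symm_apply_eq] using this
  nodup := by simpa using h.nodup.map e.injective
  diamond_s := h.diamond_s.map_iso e
  diamond_t := h.diamond_t.map_iso e
  adj_st := e.map_adj_iff.2 h.adj_st
  deg_m := (deg_iso e m).trans h.deg_m
  deg_s := (deg_iso e s).trans h.deg_s
  deg_t := (deg_iso e t).trans h.deg_t

theorem deg_of_iso_top (e : G ≃g (⊤ : SimpleGraph (Fin 4))) (v : V) : G.deg v = 3 := by
  rw [← deg_iso e, deg_eq_degree, complete_graph_degree]
  rfl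

theorem adj_of_iso_top (e : G ≃g (⊤ : SimpleGraph (Fin 4))) {u v : V} (h : u ≠ v) : G.Adj u v := by
  rw [← e.map_adj_iff]
  exact e.injective.ne h

theorem exists_of_iso_top (e : G ≃g (⊤ : SimpleGraph (Fin 4))) {u v : V} (h : u ≠ v) :
    ∃ p q, [u, v, p, q].Nodup := by
  have key : ∀ i j : Fin 4, i ≠ j → ∃ k l : Fin 4, [i, j, k, l].Nodup := by decide
  obtain ⟨k, l, hkl⟩ := key (e u) (e v) (e.injective.ne h)
  refine ⟨e.symm k, e.symm l, ?_⟩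
  simpa using hkl.map e.symm.injective

theorem eq_of_adj_of_deg_eq_three {c a b d x : V} (hc : G.deg c = 3) (ha : G.Adj c a)
    (hb : G.Adj c b) (hd : G.Adj c d) (hab : a ≠ b) (had : a ≠ d) (hbd : b ≠ d)
    (hx : G.Adj c x) : x = a ∨ x = b ∨ x = d := by
  -- An infinite set has `ncard` zero, so degree 3 already forces finiteness.
  have hfin : (G.neighborSet c).Finite := Set.finite_of_ncard_ne_zero (by unfold deg at hc; omega)
  have hsub : ({a, b, d} : Set V) ⊆ G.neighborSet c := by
    rintro t (rfl | rfl | rfl) <;> assumption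
  have hcard : ({a, b, d} : Set V).ncard = 3 := Set.ncard_eq_three.2 ⟨a, b, d, hab, had, hbd, rfl⟩
  have := Set.eq_of_subset_of_ncard_le hsub (by rw [hcard]; exact hc.le) hfin
  have hx' : x ∈ ({a, b, d} : Set V) := by rw [this]; exact hx
  simpa using hx'

end SimpleGraph

/-! ### Adjacency and degrees in an Ore-composition -/

section OreComposition

open SimpleGraph

variable {V₁ V₂ : Type u} {G₁ : SimpleGraph V₁} {G₂ : SimpleGraph V₂} {x y : V₁} {z : V₂}
  {A : Set V₂}

theorem oreComposition_adj_inl_inl {a b : V₁} :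
    (oreComposition G₁ G₂ x y z A).Adj (.inl a) (.inl b) ↔ G₁.Adj a b ∧ s(a, b) ≠ s(x, y) := Iff.rfl

theorem oreComposition_adj_inr_inr {u v : {v : V₂ // v ≠ z}} :
    (oreComposition G₁ G₂ x y z A).Adj (.inr u) (.inr v) ↔ G₂.Adj u v := Iff.rfl

theorem oreComposition_adj_inl_inr {a : V₁} {v : {v : V₂ // v ≠ z}} :
    (oreComposition G₁ G₂ x y z A).Adj (.inl a) (.inr v) ↔
      G₂.Adj z v ∧ ((a = x ∧ (v : V₂) ∈ A) ∨ (a = y ∧ (v : V₂) ∉ A)) := Iff.rfl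

theorem oreComposition_adj_inr_inl {a : V₁} {v : {v : V₂ // v ≠ z}} :
    (oreComposition G₁ G₂ x y z A).Adj (.inr v) (.inl a) ↔
      G₂.Adj z v ∧ ((a = x ∧ (v : V₂) ∈ A) ∨ (a = y ∧ (v : V₂) ∉ A)) := Iff.rfl

theorem oreComposition_swap (G₁ : SimpleGraph V₁) (G₂ : SimpleGraph V₂) (x y : V₁) (z : V₂)
    (A : Set V₂) : oreComposition G₁ G₂ y x z Aᶜ = oreComposition G₁ G₂ x y z A := by
  ext (a | u) (b | v)
  · simp only [oreComposition_adj_inl_inl, Sym2.eq_swap (a := y)]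
  · simp only [oreComposition_adj_inl_inr, Set.mem_compl_iff, not_not, or_comm]
  · simp only [oreComposition_adj_inr_inl, Set.mem_compl_iff, not_not, or_comm]
  · rfl

theorem deg_oreComposition_inl {v : V₁} (hx : v ≠ x) (hy : v ≠ y) :
    (oreComposition G₁ G₂ x y z A).deg (.inl v) = G₁.deg v := by
  unfold deg
  rw [← Set.ncard_image_of_injective (G₁.neighborSet v)
    (Sum.inl_injective (β := {v : V₂ // v ≠ z}))]
  congr 1
  ext (a | u)
  · simp only [mem_neighborSet, oreComposition_adj_inl_inl, Set.mem_image, Sum.inl.injEq,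
      exists_eq_right, ne_eq, Sym2.eq_iff]
    tauto
  · simp only [mem_neighborSet, oreComposition_adj_inl_inr, Set.mem_image, reduceCtorEq,
      and_false, exists_false]
    tauto

theorem deg_oreComposition_inr (v : {v : V₂ // v ≠ z}) :
    (oreComposition G₁ G₂ x y z A).deg (.inr v) = G₂.deg v := by
  classical
  unfold deg
  -- From the viewpoint of `v`, the vertex `z` is replaced by whichever of `x`, `y` inherits the
  -- edge `zv`.
  let f : V₂ → V₁ ⊕ {v : V₂ // v ≠ z} := fun w =>
    if h : w = z then (if (v : V₂) ∈ A then .inl x else .inl y) else .inr ⟨w, h⟩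
  have hf : f.Injective := by
    intro a b h
    simp only [f] at h
    split_ifs at h <;> simp_all
  rw [← Set.ncard_image_of_injective _ hf]
  congr 1
  ext (a | u)
  · simp only [mem_neighborSet, oreComposition_adj_inr_inl, Set.mem_image]
    constructor
    · rintro ⟨h, h' | h'⟩
      · exact ⟨z, h.symm, by simp [f, h'.1, h'.2]⟩
      · exact ⟨z, h.symm, by simp [f, h'.1, h'.2]⟩
    · rintro ⟨w, hw, h⟩
      simp only [f] at h
      split_ifs at h with h1 h2
      · subst h1
        exact ⟨hw.symm, Or.inl ⟨(Sum.inl.inj h).symm, h2⟩⟩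
      · subst h1
        exact ⟨hw.symm, Or.inr ⟨(Sum.inl.inj h).symm, h2⟩⟩
  · simp only [mem_neighborSet, oreComposition_adj_inr_inr, Set.mem_image]
    constructor
    · intro h
      exact ⟨u, h, by simp [f, u.2]⟩
    · rintro ⟨w, hw, h⟩
      simp only [f] at h
      split_ifs at h with h1 h2
      obtain rfl := Sum.inr.inj h
      exact hw

/-- The vertex `x` loses the neighbour `y` and gains the neighbours of `z` in `A`. -/
theorem deg_oreComposition_left [Finite V₁] [Finite V₂] (hxy : G₁.Adj x y) :
    (oreComposition G₁ G₂ x y z A).deg (.inl x) + 1 =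
      G₁.deg x + (G₂.neighborSet z ∩ A).ncard := by
  have hset : (oreComposition G₁ G₂ x y z A).neighborSet (.inl x) =
      Sum.inl '' (G₁.neighborSet x \ {y}) ∪
        Sum.inr '' ((Subtype.val : {v : V₂ // v ≠ z} → V₂) ⁻¹' (G₂.neighborSet z ∩ A)) := by
    ext (a | u)
    · have : a = y → y ≠ x := fun _ => hxy.ne'
      simp only [mem_neighborSet, oreComposition_adj_inl_inl, ne_eq, Sym2.eq_iff, Set.mem_union,
        Set.mem_image, Set.mem_sdiff, Set.mem_singleton_iff, Sum.inl.injEq, exists_eq_right,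
        reduceCtorEq, and_false, exists_false, or_false]
      have := hxy.ne
      tauto
    · have := hxy.ne
      simp only [mem_neighborSet, oreComposition_adj_inl_inr, Set.mem_union, Set.mem_image,
        reduceCtorEq, and_false, exists_false, false_or, Sum.inr.injEq, exists_eq_right,
        Set.mem_preimage, Set.mem_inter_iff]
      tauto
  have hpre : ((Subtype.val : {v : V₂ // v ≠ z} → V₂) ⁻¹' (G₂.neighborSet z ∩ A)).ncard =
      (G₂.neighborSet z ∩ A).ncard := by
    apply Set.ncard_preimage_of_injective_subset_range Subtype.val_injective
    rintro v ⟨hv, -⟩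
    exact ⟨⟨v, hv.ne'⟩, rfl⟩
  unfold deg
  rw [hset, Set.ncard_union_eq _ (Set.toFinite _) (Set.toFinite _),
    Set.ncard_image_of_injective _ Sum.inl_injective,
    Set.ncard_image_of_injective _ Sum.inr_injective, hpre,
    ← Set.ncard_sdiff_singleton_add_one (s := G₁.neighborSet x) (a := y) hxy]
  · omega
  · rw [Set.disjoint_left]
    rintro _ ⟨a, -, rfl⟩ ⟨b, -, h⟩
    cases h

theorem deg_oreComposition_right [Finite V₁] [Finite V₂] (hxy : G₁.Adj x y) :
    (oreComposition G₁ G₂ x y z A).deg (.inl y) + 1 =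
      G₁.deg y + (G₂.neighborSet z \ A).ncard := by
  rw [← oreComposition_swap, deg_oreComposition_left hxy.symm]
  rfl

theorem deg_split [Finite V₂] (G₂ : SimpleGraph V₂) (z : V₂) (A : Set V₂) :
    G₂.deg z = (G₂.neighborSet z ∩ A).ncard + (G₂.neighborSet z \ A).ncard :=
  (Set.ncard_inter_add_ncard_sdiff_eq_ncard _ _).symm

theorem deg_le_deg_oreComposition_inl [Finite V₁] [Finite V₂] (hxy : G₁.Adj x y)
    (hA : (G₂.neighborSet z ∩ A).Nonempty) (hA' : (G₂.neighborSet z \ A).Nonempty) (v : V₁) :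
    G₁.deg v ≤ (oreComposition G₁ G₂ x y z A).deg (.inl v) := by
  have h1 := hA.ncard_pos
  have h2 := hA'.ncard_pos
  by_cases hx : v = x
  · subst hx
    have := deg_oreComposition_left (G₂ := G₂) (z := z) (A := A) hxy
    omega
  by_cases hy : v = y
  · subst hy
    have := deg_oreComposition_right (G₂ := G₂) (z := z) (A := A) hxy
    omega
  exact (deg_oreComposition_inl hx hy).ge

/-- Ore-composition respects isomorphisms of both sides. -/
def oreCompositionCongr {W₁ W₂ : Type v} {K₁ : SimpleGraph W₁} {K₂ : SimpleGraph W₂}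
    (e₁ : G₁ ≃g K₁) (e₂ : G₂ ≃g K₂) (B : Set W₂)
    (hB : ∀ v, G₂.Adj z v → (v ∈ A ↔ e₂ v ∈ B)) :
    oreComposition G₁ G₂ x y z A ≃g oreComposition K₁ K₂ (e₁ x) (e₁ y) (e₂ z) B where
  toEquiv := Equiv.sumCongr e₁.toEquiv
    (e₂.toEquiv.subtypeEquiv fun _ => e₂.injective.ne_iff.symm)
  map_rel_iff' := by
    rintro (a | u) (b | v)
    · change K₁.Adj (e₁ a) (e₁ b) ∧ s(e₁ a, e₁ b) ≠ s(e₁ x, e₁ y) ↔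
        G₁.Adj a b ∧ s(a, b) ≠ s(x, y)
      simp [e₁.map_adj_iff]
    · change K₂.Adj (e₂ z) (e₂ v) ∧ ((e₁ a = e₁ x ∧ e₂ v ∈ B) ∨ (e₁ a = e₁ y ∧ e₂ v ∉ B)) ↔
        G₂.Adj z v ∧ ((a = x ∧ (v : V₂) ∈ A) ∨ (a = y ∧ (v : V₂) ∉ A))
      rw [e₂.map_adj_iff, e₁.injective.eq_iff, e₁.injective.eq_iff]
      exact and_congr_right fun h => by rw [hB v h]
    · change K₂.Adj (e₂ z) (e₂ u) ∧ ((e₁ b = e₁ x ∧ e₂ u ∈ B) ∨ (e₁ b = e₁ y ∧ e₂ u ∉ B)) ↔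
        G₂.Adj z u ∧ ((b = x ∧ (u : V₂) ∈ A) ∨ (b = y ∧ (u : V₂) ∉ A))
      rw [e₂.map_adj_iff, e₁.injective.eq_iff, e₁.injective.eq_iff]
      exact and_congr_right fun h => by rw [hB u h]
    · exact e₂.map_adj_iff

end OreComposition

/-! ### Good diamonds in compositions of Ore-degree at most seven -/

section Tight

open SimpleGraph

variable {V₁ V₂ : Type u} {G₁ : SimpleGraph V₁} {G₂ : SimpleGraph V₂} {x y : V₁} {z : V₂}
  {A : Set V₂}

theorem SimpleGraph.Diamond.oreComposition_inl {a b c d : V₁} (h : G₁.Diamond a b c d)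
    (hcx : c ≠ x) (hcy : c ≠ y) (hdx : d ≠ x) (hdy : d ≠ y) :
    (oreComposition G₁ G₂ x y z A).Diamond (.inl a) (.inl b) (.inl c) (.inl d) where
  ends_ne := Sum.inl_injective.ne h.ends_ne
  adj_ac := ⟨h.adj_ac, by rw [Ne, Sym2.eq_iff]; tauto⟩
  adj_ad := ⟨h.adj_ad, by rw [Ne, Sym2.eq_iff]; tauto⟩
  adj_bc := ⟨h.adj_bc, by rw [Ne, Sym2.eq_iff]; tauto⟩
  adj_bd := ⟨h.adj_bd, by rw [Ne, Sym2.eq_iff]; tauto⟩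
  adj_cd := ⟨h.adj_cd, by rw [Ne, Sym2.eq_iff]; tauto⟩
  deg_c := (deg_oreComposition_inl hcx hcy).trans h.deg_c
  deg_d := (deg_oreComposition_inl hdx hdy).trans h.deg_d

theorem SimpleGraph.Diamond.oreComposition_inr {a b c d : V₂} (h : G₂.Diamond a b c d)
    (ha : a ≠ z) (hb : b ≠ z) (hc : c ≠ z) (hd : d ≠ z) :
    (oreComposition G₁ G₂ x y z A).Diamond (.inr ⟨a, ha⟩) (.inr ⟨b, hb⟩) (.inr ⟨c, hc⟩)
      (.inr ⟨d, hd⟩) where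
  ends_ne := by simpa using h.ends_ne
  adj_ac := h.adj_ac
  adj_ad := h.adj_ad
  adj_bc := h.adj_bc
  adj_bd := h.adj_bd
  adj_cd := h.adj_cd
  deg_c := (deg_oreComposition_inr _).trans h.deg_c
  deg_d := (deg_oreComposition_inr _).trans h.deg_d

theorem mem_of_ncard_diff_eq_one [Finite V₂]
    (h1 : (G₂.neighborSet z \ A).ncard = 1) {u v : V₂}
    (hu : G₂.Adj z u) (huA : u ∉ A) (hv : G₂.Adj z v) (huv : v ≠ u) : v ∈ A := by
  by_contra hvA
  exact huv ((Set.ncard_le_one_iff).1 h1.le ⟨hv, hvA⟩ ⟨hu, huA⟩)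

/-- An Ore-composition of graphs of minimum degree at least three which has Ore-degree at most
seven, oriented so that `x` receives two of the neighbours of `z`. -/
structure TightComposition (G₁ : SimpleGraph V₁) (G₂ : SimpleGraph V₂) (x y : V₁) (z : V₂)
    (A : Set V₂) : Prop where
  adj : G₁.Adj x y
  two_le : 2 ≤ (G₂.neighborSet z ∩ A).ncard
  one_le : 1 ≤ (G₂.neighborSet z \ A).ncard
  min_left : ∀ v, 3 ≤ G₁.deg v
  min_right : ∀ v, 3 ≤ G₂.deg v
  edge_deg : (oreComposition G₁ G₂ x y z A).EdgeDegLESeven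

namespace TightComposition

variable [Finite V₁] [Finite V₂] (h : TightComposition G₁ G₂ x y z A)

include h

theorem le_deg_inl (v : V₁) : G₁.deg v ≤ (oreComposition G₁ G₂ x y z A).deg (.inl v) :=
  deg_le_deg_oreComposition_inl h.adj
    (Set.nonempty_of_ncard_ne_zero (by have := h.two_le; omega))
    (Set.nonempty_of_ncard_ne_zero (by have := h.one_le; omega)) v

theorem three_le_deg (v) : 3 ≤ (oreComposition G₁ G₂ x y z A).deg v := by
  rcases v with v | v
  · exact (h.min_left v).trans (h.le_deg_inl v)
  · rw [deg_oreComposition_inr]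
    exact h.min_right v

theorem deg_le_four (v) : (oreComposition G₁ G₂ x y z A).deg v ≤ 4 := by
  have hv := h.three_le_deg v
  obtain ⟨w, hw⟩ : ((oreComposition G₁ G₂ x y z A).neighborSet v).Nonempty :=
    Set.nonempty_of_ncard_ne_zero (by unfold deg at hv; omega)
  have := h.edge_deg v w hw
  have := h.three_le_deg w
  omega

theorem deg_x : G₁.deg x = 3 ∧ (G₂.neighborSet z ∩ A).ncard = 2 ∧
    (oreComposition G₁ G₂ x y z A).deg (.inl x) = 4 := by
  have h1 := deg_oreComposition_left (G₂ := G₂) (z := z) (A := A) h.adj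
  have := h.two_le
  have := h.min_left x
  have := h.deg_le_four (.inl x)
  omega

theorem deg_y_or :
    ((oreComposition G₁ G₂ x y z A).deg (.inl y) = 3 ∧ (G₂.neighborSet z \ A).ncard = 1 ∧
      G₁.deg y = 3) ∨
    ((oreComposition G₁ G₂ x y z A).deg (.inl y) = 4 ∧ (G₂.neighborSet z \ A).ncard = 1 ∧
      G₁.deg y = 4) ∨
    ((oreComposition G₁ G₂ x y z A).deg (.inl y) = 4 ∧ (G₂.neighborSet z \ A).ncard = 2 ∧
      G₁.deg y = 3) := by
  have h1 := deg_oreComposition_right (G₂ := G₂) (z := z) (A := A) h.adj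
  have := h.one_le
  have := h.min_left y
  have := h.deg_le_four (.inl y)
  omega

theorem deg_eq_three_of_adj {v w} (hv : (oreComposition G₁ G₂ x y z A).deg v = 4)
    (hvw : (oreComposition G₁ G₂ x y z A).Adj v w) :
    (oreComposition G₁ G₂ x y z A).deg w = 3 := by
  have := h.edge_deg v w hvw
  have := h.three_le_deg w
  omega

theorem deg_inl_of_four {v : V₁} (hv : G₁.deg v = 4) :
    (oreComposition G₁ G₂ x y z A).deg (.inl v) = 4 := by
  have := h.le_deg_inl v
  have := h.deg_le_four (.inl v)
  omega

/-- Any edge at `x` other than `xy` survives, and `x` has degree 4 in the composition, so its other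
end cannot have degree 4. -/
theorem eq_y_of_adj_x {v : V₁} (hxv : G₁.Adj x v) (hv : G₁.deg v = 4) : v = y := by
  by_contra hne
  have hadj : (oreComposition G₁ G₂ x y z A).Adj (.inl x) (.inl v) :=
    ⟨hxv, by have := h.adj.ne; rw [Ne, Sym2.eq_iff]; tauto⟩
  have := h.deg_eq_three_of_adj h.deg_x.2.2 hadj
  have := h.deg_inl_of_four hv
  omega

theorem edgeDeg_left : G₁.EdgeDegLESeven := by
  intro u v huv
  by_cases he : s(u, v) = s(x, y)
  · have := h.deg_x.1
    have : G₁.deg y ≤ 4 := by rcases h.deg_y_or with h | h | h <;> omega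
    rcases Sym2.eq_iff.1 he with ⟨rfl, rfl⟩ | ⟨rfl, rfl⟩ <;> omega
  · have := h.edge_deg (.inl u) (.inl v) ⟨huv, he⟩
    have := h.le_deg_inl u
    have := h.le_deg_inl v
    omega

/-- The degree of `z` is 3 or 4. If it is 4, both `x` and `y` end up with degree 4, which forces
every neighbour of `z` to have degree 3. -/
theorem edgeDeg_right : G₂.EdgeDegLESeven := by
  have hz : ∀ v, G₂.Adj z v → G₂.deg z + G₂.deg v ≤ 7 := by
    intro v hv
    have hd := deg_split G₂ z A
    rw [h.deg_x.2.1] at hd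
    rw [← deg_oreComposition_inr (G₁ := G₁) (x := x) (y := y) (A := A) ⟨v, hv.ne'⟩]
    have hle := h.deg_le_four (.inr ⟨v, hv.ne'⟩)
    rcases h.deg_y_or with hy | hy | hy
    · omega
    · omega
    · have : (oreComposition G₁ G₂ x y z A).deg (.inr ⟨v, hv.ne'⟩) = 3 := by
        by_cases hvA : v ∈ A
        · exact h.deg_eq_three_of_adj (v := .inl x) h.deg_x.2.2 ⟨hv, Or.inl ⟨rfl, hvA⟩⟩
        · exact h.deg_eq_three_of_adj (v := .inl y) hy.1 ⟨hv, Or.inr ⟨rfl, hvA⟩⟩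
      omega
  intro u v huv
  by_cases hu : u = z
  · subst hu
    exact hz v huv
  by_cases hv : v = z
  · subst hv
    rw [add_comm]
    exact hz u huv.symm
  have := h.edge_deg (.inr ⟨u, hu⟩) (.inr ⟨v, hv⟩) huv
  rwa [deg_oreComposition_inr, deg_oreComposition_inr] at this

theorem deg_eq_three_of_mem {v : V₂} (hv : G₂.Adj z v) (hvA : v ∈ A) : G₂.deg v = 3 := by
  rw [← deg_oreComposition_inr (G₁ := G₁) (x := x) (y := y) (A := A) ⟨v, hv.ne'⟩]
  exact h.deg_eq_three_of_adj (v := .inl x) h.deg_x.2.2 ⟨hv, Or.inl ⟨rfl, hvA⟩⟩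

theorem deg_eq_three_of_not_mem (hy : (oreComposition G₁ G₂ x y z A).deg (.inl y) = 4) {v : V₂}
    (hv : G₂.Adj z v) (hvA : v ∉ A) : G₂.deg v = 3 := by
  rw [← deg_oreComposition_inr (G₁ := G₁) (x := x) (y := y) (A := A) ⟨v, hv.ne'⟩]
  exact h.deg_eq_three_of_adj (v := .inl y) hy ⟨hv, Or.inr ⟨rfl, hvA⟩⟩

-- Each vertex of a good diamond has degree 4 or a neighbour of degree 4. Since `z` has neither, the
-- diamond avoids the split.
omit [Finite V₁] [Finite V₂] in
theorem good_of_right_good (hz3 : G₂.deg z = 3) (hz : ∀ v, G₂.Adj z v → G₂.deg v = 3)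
    (hG : G₂.HasGoodDiamond) : (oreComposition G₁ G₂ x y z A).HasGoodDiamond := by
  obtain ⟨a, b, c, d, hD, ha, hb⟩ := hG
  have ha' : a ≠ z := by rintro rfl; omega
  have hc' : c ≠ z := by rintro rfl; have := hz a hD.adj_ac.symm; omega
  have hd' : d ≠ z := by rintro rfl; have := hz a hD.adj_ad.symm; omega
  have hb' : b ≠ z := by
    rintro rfl
    rcases hb with hb | ⟨w, hw, hw4⟩
    · omega
    · have := hz w hw; omega
  refine ⟨_, _, _, _, hD.oreComposition_inr ha' hb' hc' hd',
    (deg_oreComposition_inr _).trans ha, ?_⟩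
  rcases hb with hb | ⟨w, hw, hw4⟩
  · exact Or.inl ((deg_oreComposition_inr _).trans hb)
  · have hw' : w ≠ z := by rintro rfl; omega
    exact Or.inr ⟨.inr ⟨w, hw'⟩, hw, (deg_oreComposition_inr _).trans hw4⟩

/-- The neighbours of `z` are `t`, `p`, `q`, and only one goes to `y`. If `t` goes to `x`, the
diamond at `t` becomes good. If `t` goes to `y`, then `p` and `q` go to `x`, which replaces `z` as
an end. -/
theorem good_of_split_diamond_end (h1 : (G₂.neighborSet z \ A).ncard = 1) {m t p q v w : V₂}
    (hG : G₂.DoubleDiamond z t m p q v w) : (oreComposition G₁ G₂ x y z A).HasGoodDiamond := by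
  have hnd := hG.nodup
  simp only [List.nodup_cons, List.mem_cons, List.not_mem_nil, or_false, not_or,
    List.nodup_nil, and_true, not_false_eq_true] at hnd
  obtain ⟨⟨hzt, hzm, hzp, hzq, hzv, hzw⟩, ⟨-, htp, htq, -, -⟩, -⟩ := hnd
  by_cases htA : t ∈ A
  · exact ⟨_, _, _, _, hG.diamond_t.oreComposition_inr (Ne.symm hzm) (Ne.symm hzt) (Ne.symm hzv)
      (Ne.symm hzw), (deg_oreComposition_inr _).trans hG.deg_m,
      Or.inr ⟨.inl x, ⟨hG.adj_st, Or.inl ⟨rfl, htA⟩⟩, h.deg_x.2.2⟩⟩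
  · have hD := hG.diamond_s
    have hp := mem_of_ncard_diff_eq_one h1 hG.adj_st htA hD.adj_bc (Ne.symm htp)
    have hq := mem_of_ncard_diff_eq_one h1 hG.adj_st htA hD.adj_bd (Ne.symm htq)
    exact ⟨.inr ⟨m, Ne.symm hzm⟩, .inl x, .inr ⟨p, Ne.symm hzp⟩, .inr ⟨q, Ne.symm hzq⟩,
      ⟨Sum.inr_ne_inl, hD.adj_ac, hD.adj_ad, ⟨hD.adj_bc, Or.inl ⟨rfl, hp⟩⟩,
        ⟨hD.adj_bd, Or.inl ⟨rfl, hq⟩⟩, hD.adj_cd, (deg_oreComposition_inr _).trans hD.deg_c,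
        (deg_oreComposition_inr _).trans hD.deg_d⟩,
      (deg_oreComposition_inr _).trans hG.deg_m, Or.inl h.deg_x.2.2⟩

theorem good_of_right_doubleDiamond (h1 : (G₂.neighborSet z \ A).ncard = 1)
    (hz3 : G₂.deg z = 3) (hz : ∀ v, G₂.Adj z v → G₂.deg v = 3) {s t m p q v w : V₂}
    (hG : G₂.DoubleDiamond s t m p q v w) : (oreComposition G₁ G₂ x y z A).HasGoodDiamond := by
  have hm : ¬ G₂.Adj z m := fun hzm => by have := hz m hzm; have := hG.deg_m; omega
  rcases hG.cover z with rfl | rfl | rfl | rfl | rfl | rfl | rfl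
  · exact h.good_of_split_diamond_end h1 hG
  · exact h.good_of_split_diamond_end h1 hG.symm
  · have := hG.deg_m; omega
  · exact absurd hG.diamond_s.adj_ac.symm hm
  · exact absurd hG.diamond_s.adj_ad.symm hm
  · exact absurd hG.diamond_t.adj_ac.symm hm
  · exact absurd hG.diamond_t.adj_ad.symm hm

/-- With `r` the neighbour of `z` given to `y`, the other two span a diamond with ends `x` and `r`,
and `r` is adjacent to `y`. -/
theorem good_of_right_top (h1 : (G₂.neighborSet z \ A).ncard = 1)
    (hy : (oreComposition G₁ G₂ x y z A).deg (.inl y) = 4) (e : G₂ ≃g (⊤ : SimpleGraph (Fin 4))) :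
    (oreComposition G₁ G₂ x y z A).HasGoodDiamond := by
  obtain ⟨r, hzr, hrA⟩ := Set.nonempty_of_ncard_ne_zero (h1.trans_ne one_ne_zero)
  obtain ⟨p, q, hnd⟩ := exists_of_iso_top e (u := z) (v := r) hzr.ne
  simp only [List.nodup_cons, List.mem_cons, List.not_mem_nil, or_false, not_or,
    List.nodup_nil, and_true, not_false_eq_true] at hnd
  obtain ⟨⟨-, hzp, hzq⟩, ⟨hrp, hrq⟩, hpq⟩ := hnd
  have ap := adj_of_iso_top e hzp
  have aq := adj_of_iso_top e hzq
  have hp := mem_of_ncard_diff_eq_one h1 hzr hrA ap (Ne.symm hrp)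
  have hq := mem_of_ncard_diff_eq_one h1 hzr hrA aq (Ne.symm hrq)
  exact ⟨.inl x, .inr ⟨r, hzr.ne'⟩, .inr ⟨p, ap.ne'⟩, .inr ⟨q, aq.ne'⟩,
    ⟨Sum.inl_ne_inr, ⟨ap, Or.inl ⟨rfl, hp⟩⟩, ⟨aq, Or.inl ⟨rfl, hq⟩⟩, adj_of_iso_top e hrp,
      adj_of_iso_top e hrq, adj_of_iso_top e hpq,
      (deg_oreComposition_inr _).trans (deg_of_iso_top e _),
      (deg_oreComposition_inr _).trans (deg_of_iso_top e _)⟩,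
    h.deg_x.2.2, Or.inr ⟨.inl y, ⟨hzr, Or.inr ⟨rfl, hrA⟩⟩, hy⟩⟩

/-- Both `x` and `y` have degree 4 in the composition, so `z` and all its neighbours have degree 3
in `G₂`. -/
theorem good_of_deg_y_eq_four (hy : G₁.deg y = 4) (hG : G₂.Trichotomy) :
    (oreComposition G₁ G₂ x y z A).HasGoodDiamond := by
  obtain ⟨hy4, h1⟩ : (oreComposition G₁ G₂ x y z A).deg (.inl y) = 4 ∧
      (G₂.neighborSet z \ A).ncard = 1 := by
    rcases h.deg_y_or with h | h | h <;> omega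
  have hz3 : G₂.deg z = 3 := by rw [deg_split G₂ z A, h.deg_x.2.1, h1]
  have hz : ∀ v, G₂.Adj z v → G₂.deg v = 3 := fun v hv => by
    by_cases hvA : v ∈ A
    · exact h.deg_eq_three_of_mem hv hvA
    · exact h.deg_eq_three_of_not_mem hy4 hv hvA
  rcases hG with ⟨⟨e⟩⟩ | ⟨s, t, m, p, q, v, w, hG⟩ | hG
  · exact h.good_of_right_top h1 hy4 e
  · exact h.good_of_right_doubleDiamond h1 hz3 hz hG
  · exact h.good_of_right_good hz3 hz hG

theorem good_of_left_top (e : G₁ ≃g (⊤ : SimpleGraph (Fin 4))) (hG : G₂.Trichotomy) :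
    (Nonempty (G₂ ≃g (⊤ : SimpleGraph (Fin 4))) ∧ (G₂.neighborSet z \ A).ncard = 1) ∨
      (oreComposition G₁ G₂ x y z A).HasGoodDiamond := by
  obtain ⟨p, q, hnd⟩ := exists_of_iso_top e h.adj.ne
  simp only [List.nodup_cons, List.mem_cons, List.not_mem_nil, or_false, not_or,
    List.nodup_nil, and_true, not_false_eq_true] at hnd
  obtain ⟨⟨hxy, hxp, hxq⟩, ⟨hyp, hyq⟩, hpq⟩ := hnd
  have hD₁ : G₁.Diamond x y p q := ⟨hxy, adj_of_iso_top e hxp, adj_of_iso_top e hxq,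
    adj_of_iso_top e hyp, adj_of_iso_top e hyq, adj_of_iso_top e hpq, deg_of_iso_top e p,
    deg_of_iso_top e q⟩
  have hD := hD₁.oreComposition_inl (G₂ := G₂) (z := z) (A := A) (Ne.symm hxp) (Ne.symm hyp)
    (Ne.symm hxq) (Ne.symm hyq)
  by_cases hgood : (oreComposition G₁ G₂ x y z A).HasGoodDiamond
  · exact Or.inr hgood
  have hy : (oreComposition G₁ G₂ x y z A).deg (.inl y) ≠ 4 := fun hy =>
    hgood ⟨_, _, _, _, hD, h.deg_x.2.2, Or.inl hy⟩
  have h1 : (G₂.neighborSet z \ A).ncard = 1 := by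
    rcases h.deg_y_or with h | h | h <;> omega
  have hz3 : G₂.deg z = 3 := by rw [deg_split G₂ z A, h.deg_x.2.1, h1]
  have hz : ∀ v, G₂.Adj z v → G₂.deg v = 3 := fun v hv => by
    by_cases hvA : v ∈ A
    · exact h.deg_eq_three_of_mem hv hvA
    · by_contra hv3
      refine hgood ⟨_, _, _, _, hD, h.deg_x.2.2,
        Or.inr ⟨.inr ⟨v, hv.ne'⟩, ⟨hv, Or.inr ⟨rfl, hvA⟩⟩, ?_⟩⟩
      have := h.min_right v
      have := h.deg_le_four (.inr ⟨v, hv.ne'⟩)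
      rw [deg_oreComposition_inr] at this ⊢
      simp only at this ⊢
      omega
  rcases hG with hG | ⟨s, t, m, p, q, v, w, hG⟩ | hG
  · exact Or.inl ⟨hG, h1⟩
  · exact Or.inr (h.good_of_right_doubleDiamond h1 hz3 hz hG)
  · exact Or.inr (h.good_of_right_good hz3 hz hG)

theorem good_of_left_diamond_end {t m p q v w : V₁} (hG : G₁.DoubleDiamond x t m p q v w) :
    (oreComposition G₁ G₂ x y z A).HasGoodDiamond := by
  have hnd := hG.nodup
  simp only [List.nodup_cons, List.mem_cons, List.not_mem_nil, or_false, not_or,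
    List.nodup_nil, and_true, not_false_eq_true] at hnd
  by_cases hpq : p = y ∨ q = y
  -- The deleted edge lies in the diamond at `x`. The other diamond is intact, and its end `t` is
  -- still adjacent to `x`.
  · refine ⟨_, _, _, _, hG.diamond_t.oreComposition_inl ?_ ?_ ?_ ?_, h.deg_inl_of_four hG.deg_m,
      Or.inr ⟨.inl x, ⟨hG.adj_st.symm, ?_⟩, h.deg_x.2.2⟩⟩ <;> grind
  · refine ⟨_, _, _, _, hG.diamond_s.oreComposition_inl ?_ ?_ ?_ ?_, h.deg_inl_of_four hG.deg_m,
      Or.inl h.deg_x.2.2⟩ <;> grind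

theorem good_of_left_doubleDiamond {s t m p q v w : V₁} (hG : G₁.DoubleDiamond s t m p q v w)
    (hG₂ : G₂.Trichotomy) : (oreComposition G₁ G₂ x y z A).HasGoodDiamond := by
  have hm : G₁.Adj x m → (oreComposition G₁ G₂ x y z A).HasGoodDiamond := fun hxm =>
    h.good_of_deg_y_eq_four (h.eq_y_of_adj_x hxm hG.deg_m ▸ hG.deg_m) hG₂
  have hx := h.deg_x.1
  rcases hG.cover x with rfl | rfl | rfl | rfl | rfl | rfl | rfl
  · exact h.good_of_left_diamond_end hG
  · exact h.good_of_left_diamond_end hG.symm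
  · have := hG.deg_m; omega
  · exact hm hG.diamond_s.adj_ac.symm
  · exact hm hG.diamond_s.adj_ad.symm
  · exact hm hG.diamond_t.adj_ac.symm
  · exact hm hG.diamond_t.adj_ad.symm

/-- The second vertex of the deleted edge is not an internal vertex of a good diamond. -/
theorem ne_internal {a b c d : V₁} (hD : G₁.Diamond a b c d) (ha : G₁.deg a = 4)
    (hb : G₁.deg b = 4 ∨ ∃ w, G₁.Adj b w ∧ G₁.deg w = 4) (hdx : d ≠ x) : c ≠ y := by
  rintro rfl
  have hx := h.deg_x.1
  -- If `c = y`, then `x` is one of the three neighbours `a`, `b`, `d` of `c`. A degree-4 neighbour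
  -- of `b = x` would have to be `y = c`, of degree 3.
  rcases eq_of_adj_of_deg_eq_three hD.deg_c hD.adj_ac.symm hD.adj_bc.symm hD.adj_cd hD.ends_ne
    hD.adj_ad.ne hD.adj_bd.ne h.adj.symm with rfl | rfl | rfl
  · omega
  · rcases hb with hb | ⟨w, hw, hw4⟩
    · omega
    · obtain rfl := h.eq_y_of_adj_x hw hw4
      have := hD.deg_c
      omega
  · exact hdx rfl

theorem good_of_left_good (hG : G₁.HasGoodDiamond) (hG₂ : G₂.Trichotomy) :
    (oreComposition G₁ G₂ x y z A).HasGoodDiamond := by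
  obtain ⟨a, b, c, d, hD, ha, hb⟩ := hG
  have hx : G₁.Adj x a → (oreComposition G₁ G₂ x y z A).HasGoodDiamond := fun hxa =>
    h.good_of_deg_y_eq_four (h.eq_y_of_adj_x hxa ha ▸ ha) hG₂
  by_cases hcx : c = x
  · exact hx (hcx ▸ hD.adj_ac.symm)
  by_cases hdx : d = x
  · exact hx (hdx ▸ hD.adj_ad.symm)
  refine ⟨_, _, _, _, hD.oreComposition_inl hcx (h.ne_internal hD ha hb hdx) hdx
    (h.ne_internal hD.symm_internal ha hb hcx), h.deg_inl_of_four ha, ?_⟩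
  rcases hb with hb | ⟨w, hw, hw4⟩
  · exact Or.inl (h.deg_inl_of_four hb)
  · by_cases he : s(b, w) = s(x, y)
    · rcases Sym2.eq_iff.1 he with ⟨rfl, rfl⟩ | ⟨rfl, rfl⟩
      -- The deleted edge was the witness for `b = x`, but now `b` itself has degree 4.
      · exact Or.inl h.deg_x.2.2
      · have := h.deg_x.1
        omega
    · exact Or.inr ⟨.inl w, ⟨hw, he⟩, h.deg_inl_of_four hw4⟩

end TightComposition

end Tight

/-! ### The graph `H₇` and the induction -/

section Main

open SimpleGraph

instance decidableRelAdjH7 : DecidableRel H7.Adj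
  | .inl a, .inl b => inferInstanceAs (Decidable (a ≠ b ∧ s(a, b) ≠ s(0, 1)))
  | .inr u, .inr v => inferInstanceAs (Decidable ((u : Fin 4) ≠ v))
  | .inl a, .inr v => inferInstanceAs
      (Decidable (0 ≠ (v : Fin 4) ∧ ((a = 0 ∧ (v : Fin 4) = 1) ∨ (a = 1 ∧ ¬ (v : Fin 4) = 1))))
  | .inr v, .inl a => inferInstanceAs
      (Decidable (0 ≠ (v : Fin 4) ∧ ((a = 0 ∧ (v : Fin 4) = 1) ∨ (a = 1 ∧ ¬ (v : Fin 4) = 1))))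

theorem exists_doubleDiamond_H7 : ∃ s t m p q v w, H7.DoubleDiamond s t m p q v w := by
  refine ⟨.inl 0, .inr ⟨1, by decide⟩, .inl 1, .inl 2, .inl 3, .inr ⟨2, by decide⟩,
    .inr ⟨3, by decide⟩, by decide, by decide, ⟨by decide, by decide, by decide, by decide,
    by decide, by decide, ?_, ?_⟩, ⟨by decide, by decide, by decide, by decide,
    by decide, by decide, ?_, ?_⟩, by decide, ?_, ?_, ?_⟩ <;> rw [deg_eq_degree] <;> decide

theorem trichotomy_of_iso_H7 {V : Type*} {G : SimpleGraph V} (e : G ≃g H7) : G.Trichotomy := by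
  obtain ⟨s, t, m, p, q, v, w, h⟩ := exists_doubleDiamond_H7
  exact Or.inr (Or.inl ⟨_, _, _, _, _, _, _, h.map_iso e.symm⟩)

theorem nonempty_iso_H7 {V₁ V₂ : Type u} {G₁ : SimpleGraph V₁} {G₂ : SimpleGraph V₂} {x y : V₁}
    {z : V₂} {A : Set V₂} (e₁ : G₁ ≃g (⊤ : SimpleGraph (Fin 4)))
    (e₂ : G₂ ≃g (⊤ : SimpleGraph (Fin 4))) (hxy : G₁.Adj x y)
    (h1 : (G₂.neighborSet z \ A).ncard = 1) :
    Nonempty (oreComposition G₁ G₂ x y z A ≃g H7) := by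
  have key : ∀ i j : Fin 4, i ≠ j → ∃ σ : Equiv.Perm (Fin 4), σ i = 0 ∧ σ j = 1 := by decide
  obtain ⟨r, hr⟩ := Set.ncard_eq_one.1 h1
  have hmem : r ∈ G₂.neighborSet z \ A := by rw [hr]; rfl
  -- In `H7` the vertex 0 receives one neighbour and 1 receives two, so `x` must go to 1 and `y` to
  -- 0; the swap of the two ends then matches the definition.
  obtain ⟨σ, hσy, hσx⟩ := key (e₁ y) (e₁ x) (e₁.injective.ne hxy.ne')
  obtain ⟨τ, hτz, hτr⟩ := key (e₂ z) (e₂ r) (e₂.injective.ne hmem.1.ne)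
  let f₁ : G₁ ≃g (⊤ : SimpleGraph (Fin 4)) := e₁.trans (Iso.completeGraph σ)
  let f₂ : G₂ ≃g (⊤ : SimpleGraph (Fin 4)) := e₂.trans (Iso.completeGraph τ)
  have hx : f₁ x = 1 := hσx
  have hy : f₁ y = 0 := hσy
  have hz : f₂ z = 0 := hτz
  have hf : f₂ r = 1 := hτr
  have hA : ∀ v, G₂.Adj z v → (v ∈ A ↔ f₂ v ∈ ({1}ᶜ : Set (Fin 4))) := by
    intro v hv
    rw [Set.mem_compl_iff, Set.mem_singleton_iff, ← hf, f₂.injective.eq_iff]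
    constructor
    · rintro hvA rfl
      exact hmem.2 hvA
    · intro hvr
      by_contra hvA
      have : v ∈ G₂.neighborSet z \ A := ⟨hv, hvA⟩
      rw [hr] at this
      exact hvr this
  have e := oreCompositionCongr (x := x) (y := y) f₁ f₂ _ hA
  rw [hx, hy, hz, oreComposition_swap] at e
  exact ⟨e⟩

/-- As `z` has at least three neighbours, one side receives two; exchanging `x` with `y` and `A`
with its complement makes it the side of `x`. -/
theorem IsOreComposition.exists_two_le {V₁ V₂ V : Type u} [Finite V₂] {G₁ : SimpleGraph V₁}
    {G₂ : SimpleGraph V₂} {G : SimpleGraph V} (h : IsOreComposition G₁ G₂ G)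
    (hmin : ∀ v, 3 ≤ G₂.deg v) : ∃ (x y : V₁) (z : V₂) (A : Set V₂), G₁.Adj x y ∧
      2 ≤ (G₂.neighborSet z ∩ A).ncard ∧ 1 ≤ (G₂.neighborSet z \ A).ncard ∧
      Nonempty (G ≃g oreComposition G₁ G₂ x y z A) := by
  obtain ⟨x, y, z, A, hxy, hA, hA', e⟩ := h
  have h1 : 1 ≤ (G₂.neighborSet z ∩ A).ncard := (Set.ncard_pos).2 hA
  have h2 : 1 ≤ (G₂.neighborSet z \ A).ncard := (Set.ncard_pos).2 hA'
  have hd := deg_split G₂ z A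
  have := hmin z
  by_cases h : 2 ≤ (G₂.neighborSet z ∩ A).ncard
  · exact ⟨x, y, z, A, hxy, h, h2, e⟩
  · refine ⟨y, x, z, Aᶜ, hxy.symm, ?_, ?_, ?_⟩
    · change 2 ≤ (G₂.neighborSet z \ A).ncard
      omega
    · rwa [Set.sdiff_compl]
    · rwa [oreComposition_swap]

theorem IsOreGraph.finite {k : ℕ} {V : Type u} {G : SimpleGraph V} (h : IsOreGraph k G) :
    Finite V := by
  induction h with
  | complete G h => exact Finite.of_equiv _ h.some.toEquiv.symm
  | comp G₁ G₂ G _ _ h ih₁ ih₂ =>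
    obtain ⟨x, y, z, A, -, -, -, ⟨e⟩⟩ := h
    exact Finite.of_equiv _ e.toEquiv.symm

theorem IsOreGraph.three_le_deg {V : Type u} {G : SimpleGraph V} (h : IsOreGraph 4 G) (v : V) :
    3 ≤ G.deg v := by
  induction h with
  | complete G h => exact (deg_of_iso_top h.some v).ge
  | comp G₁ G₂ G h₁ h₂ h ih₁ ih₂ =>
    have := h₁.finite
    have := h₂.finite
    obtain ⟨x, y, z, A, hxy, hA, hA', ⟨e⟩⟩ := h
    rw [← deg_iso e]
    rcases e v with w | w
    · exact (ih₁ w).trans (deg_le_deg_oreComposition_inl hxy hA hA' w)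
    · rw [deg_oreComposition_inr]
      exact ih₂ w

theorem IsOreGraph.classification {V : Type u} {G : SimpleGraph V} (h : IsOreGraph 4 G)
    (hG : G.EdgeDegLESeven) :
    (Nonempty (G ≃g (⊤ : SimpleGraph (Fin 4))) ∨ Nonempty (G ≃g H7)) ∨ G.HasGoodDiamond := by
  induction h with
  | complete G h => exact Or.inl (Or.inl h)
  | comp G₁ G₂ G h₁ h₂ h ih₁ ih₂ =>
    have := h₁.finite
    have := h₂.finite
    obtain ⟨x, y, z, A, hxy, hA, hA', ⟨e⟩⟩ := h.exists_two_le h₂.three_le_deg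
    have ht : TightComposition G₁ G₂ x y z A :=
      ⟨hxy, hA, hA', h₁.three_le_deg, h₂.three_le_deg, hG.of_iso e⟩
    have hG₂ : G₂.Trichotomy := by
      rcases ih₂ ht.edgeDeg_right with (h | ⟨⟨f⟩⟩) | h
      · exact Or.inl h
      · exact trichotomy_of_iso_H7 f
      · exact Or.inr (Or.inr h)
    rcases ih₁ ht.edgeDeg_left with (⟨⟨f⟩⟩ | ⟨⟨f⟩⟩) | h
    · rcases ht.good_of_left_top f hG₂ with ⟨⟨f₂⟩, h1⟩ | hgood
      · obtain ⟨g⟩ := nonempty_iso_H7 f f₂ hxy h1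
        exact Or.inl (Or.inr ⟨e.trans g⟩)
      · exact Or.inr (hgood.of_iso e.symm)
    · obtain ⟨s, t, m, p, q, v, w, hD⟩ := exists_doubleDiamond_H7
      exact Or.inr ((ht.good_of_left_doubleDiamond (hD.map_iso f.symm) hG₂).of_iso e.symm)
    · exact Or.inr ((ht.good_of_left_good h hG₂).of_iso e.symm)

end Main

theorem mainTheorem4 {V : Type u} [Fintype V] (G : SimpleGraph V) [DecidableRel G.Adj]
    (hG : IsOreGraph 4 G) (hdeg : oreDegree G ≤ 7) :
    (Nonempty (G ≃g (⊤ : SimpleGraph (Fin 4))) ∨ Nonempty (G ≃g H7)) ∨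
    (∃ a b c d : V, IsDiamond G a b c d ∧ G.degree a = 4 ∧ G.degree b = 4) ∨
    (∃ a b c d : V, IsDiamond G a b c d ∧ G.degree a = 4 ∧ G.degree b = 3 ∧
      ∃ w : V, G.Adj b w ∧ G.degree w = 4) := by
  have hE : G.EdgeDegLESeven := by
    intro u v huv
    rw [SimpleGraph.deg_eq_degree, SimpleGraph.deg_eq_degree]
    exact (Finset.sup_le_iff.1 hdeg) (u, v) (by simpa using huv)
  refine (hG.classification hE).imp_right ?_
  rintro ⟨a, b, c, d, hD, ha, hb⟩
  have hD' : IsDiamond G a b c d := ⟨hD.ends_ne, hD.adj_ac, hD.adj_ad, hD.adj_bc, hD.adj_bd,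
    hD.adj_cd, (SimpleGraph.deg_eq_degree c).symm.trans hD.deg_c,
    (SimpleGraph.deg_eq_degree d).symm.trans hD.deg_d⟩
  rw [SimpleGraph.deg_eq_degree] at ha
  rcases hb with hb | ⟨w, hw, hw4⟩
  · rw [SimpleGraph.deg_eq_degree] at hb
    exact Or.inl ⟨a, b, c, d, hD', ha, hb⟩
  · have h1 := hE b w hw
    have h2 := hG.three_le_deg b
    rw [SimpleGraph.deg_eq_degree] at h1 h2 hw4
    rw [SimpleGraph.deg_eq_degree] at h1
    exact Or.inr ⟨a, b, c, d, hD', ha, by omega, w, hw, hw4⟩
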